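/- Let $d, d_\theta, k$ be positive integers and let $\mathbb{S}^m$ denote the unit sphere of $\mathbb{R}^{m+1}$. Let $h\colon \mathbb{S}^d\to\mathbb{S}^{d_\theta}$ be continuous and injective. A spherical tree with $k$ edges in $\mathbb{S}^{d_\theta}$ is a tuple $\mathcal{T}=(x;y_1,\dots,y_k)$ with root $x\in\mathbb{S}^{d_\theta}$ and directions $y_i\in\mathbb{S}^{d_\theta}$, $\langle x,y_i\rangle=0$; as a metric space it is the gluing of $k$ copies of $[0,\pi]$ (the edges, with points $(t,i)$, $t\in[0,\pi]$) at the root $t=0$, with the tree metric $d_{\mathcal T}((s,i),(t,i))=|s-t|$ and $d_{\mathcal T}((s,i),(t,j))=s+t$ for $i\ne j$. Let $\mathbb{T}^{d_\theta}_k$ be the space of these trees, with the topology induced from $(\mathbb{S}^{d_\theta})^{1+k}$, and let $\sigma$ be the probability distribution on $\mathbb{T}^{d_\theta}_k$ for which $x$ is uniform on $\mathbb{S}^{d_\theta}$ and, given $x$, the directions $y_1,\dots,y_k$ are independent and uniform on the unit sphere of $x^\perp$. Let $\alpha\colon \mathbb{S}^{d_\theta}\times\mathbb{T}^{d_\theta}_k\to\Delta_{k-1}$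 be a continuous map into the standard simplex (a splitting map). For a Borel probability measure $\mu$ on $\mathbb{S}^d$, its Spatial Spherical Radon Transform $\mathcal{H}^\alpha_{\mathcal T}\mu$ is the probability measure on $\mathcal{T}$ given by $$\int_{\mathcal T}\varphi\,d(\mathcal{H}^\alpha_{\mathcal T}\mu)=\sum_{i=1}^k\int_{\mathbb{S}^d}\varphi\bigl(\arccos\langle x,h(y)\rangle,\,i\bigr)\,\alpha(h(y),\mathcal{T})_i\,d\mu(y);$$ for $\mu$ with density $f$ this is the formula $(t,i)\mapsto\int_{\mathbb{S}^d} f(y)\,\alpha(h(y),\mathcal T)_i\,\delta(t-\arccos\langle x,h(y)\rangle)\,dy$. Let $\mathrm{W}$ be the $1$-Wasserstein distance on $\mathcal{T}$ with respect to $d_{\mathcal T}$, i.e. the infimum of $\int d_{\mathcal T}\,d\gamma$ over all couplings $\gamma$, and put $$\mathrm{SpatialSTSW}(\mu,\nu)=\int_{\mathbb{T}^{d_\theta}_k}\mathrm{W}\bigl(\mathcal{H}^\alpha_{\mathcal T}\mu,\mathcal{H}^\alpha_{\mathcal T}\nu\bigr)\,d\sigma(\mathcal{T}).$$ **Theorem.**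 SpatialSTSW is a well-defined metric on the set $\mathcal{P}(\mathbb{S}^d)$ of all Borel probability measures on $\mathbb{S}^d$: the integrand is a finite and measurable function of $\mathcal{T}$, and $\mathrm{SpatialSTSW}$ is finite and non-negative, vanishes exactly if $\mu=\nu$, is symmetric, and satisfies the triangle inequality. -/

import Mathlib

open MeasureTheory Set
open scoped ENNReal Real

noncomputable section

/-- The unit sphere `S^d` of `ℝ^(d+1)`. -/
abbrev USphere (d : ℕ) : Type :=
  Metric.sphere (0 : EuclideanSpace ℝ (Fin (d + 1))) 1

/-- The space of spherical trees with `k` edges in `S^d`. A tree is given by its root `x ∈ S^d` and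
the directions `y₁, …, y_k` of its edges, which are unit vectors of the hyperplane orthogonal to
`x`. The topology and the σ-algebra are those induced from `S^d × (S^d)^k`. -/
abbrev SphericalTree (d k : ℕ) : Type :=
  {p : USphere d × (Fin k → USphere d) //
    ∀ i, inner ℝ (p.1 : EuclideanSpace ℝ (Fin (d + 1))) (p.2 i) = 0}

/-- The root of a spherical tree. -/
def SphericalTree.root {d k : ℕ} (T : SphericalTree d k) : USphere d := T.1.1

/-- A point of one of `k` spherical rays, before gluing: the index of the ray and the coordinate
`t ∈ [0, π]` on it, which is the spherical distance to the root. -/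
structure RayPoint (k : ℕ) where
  edge : Fin k
  coord : ℝ
  mem : coord ∈ Icc 0 π

/-- The tree distance: along the ray for two points of the same ray, through the root otherwise. -/
instance RayPoint.instPseudoMetricSpace (k : ℕ) : PseudoMetricSpace (RayPoint k) where
  dist p q := if p.edge = q.edge then |p.coord - q.coord| else p.coord + q.coord
  dist_self p := by simp
  dist_comm p q := by
    simp only [eq_comm (a := p.edge), abs_sub_comm p.coord, add_comm p.coord]
  dist_triangle p q r := by
    have hp := p.mem.1
    have hq := q.mem.1
    have hr := r.mem.1
    split_ifs <;> grind

/-- The metric space underlying a spherical tree with `k` edges: the gluing of `k` rays `[0, π]` at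
the root `t = 0`, with the tree metric. (Two points of `RayPoint k` have distance `0` exactly if
they are equal or both are the root.) In the coordinates `(t, i)` this space is the same for all
trees with `k` edges. -/
def TreeSpace (k : ℕ) : Type := SeparationQuotient (RayPoint k)

instance TreeSpace.instMetricSpace (k : ℕ) : MetricSpace (TreeSpace k) :=
  inferInstanceAs (MetricSpace (SeparationQuotient (RayPoint k)))

instance TreeSpace.instMeasurableSpace (k : ℕ) : MeasurableSpace (TreeSpace k) := borel _

instance TreeSpace.instBorelSpace (k : ℕ) : BorelSpace (TreeSpace k) := ⟨rfl⟩

/-- The point with coordinate `t` on the `i`-th ray. -/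
def TreeSpace.mk {k : ℕ} (i : Fin k) (t : ℝ) (ht : t ∈ Icc 0 π) : TreeSpace k :=
  SeparationQuotient.mk (⟨i, t, ht⟩ : RayPoint k)

theorem TreeSpace.dist_mk {k : ℕ} (i j : Fin k) (s t : ℝ) (hs : s ∈ Icc 0 π) (ht : t ∈ Icc 0 π) :
    dist (TreeSpace.mk i s hs) (TreeSpace.mk j t ht) = if i = j then |s - t| else s + t :=
  rfl

/-- The `1`-Wasserstein distance of two measures on a metric space: the infimum, over all couplings,
of the expected distance. -/
def wassersteinDist {X : Type*} [MetricSpace X] [MeasurableSpace X] (μ ν : Measure X) : ℝ≥0∞ :=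
  ⨅ (γ : Measure (X × X)) (_ : γ.map Prod.fst = μ ∧ γ.map Prod.snd = ν), ∫⁻ z, edist z.1 z.2 ∂γ

/-- The map of `S^d` to the `i`-th edge of the tree `T` in `S^n`, `y ↦ (arccos ⟨x, h y⟩, i)`,
where `x` is the root of `T`. -/
def treeProj {d n k : ℕ} (h : USphere d → USphere n) (T : SphericalTree n k) (i : Fin k)
    (y : USphere d) : TreeSpace k :=
  TreeSpace.mk i
    (Real.arccos (inner ℝ (T.root : EuclideanSpace ℝ (Fin (n + 1))) (h y)))
    ⟨Real.arccos_nonneg _, Real.arccos_le_pi _⟩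

/-- The Spatial Spherical Radon Transform of a measure `μ` on `S^d` along the tree `T`, as a measure
on `T`: the part `α(h(y), T)ᵢ μ(dy)` of `μ` is projected to the `i`-th edge. For `μ = f dy` this is
the formula `(t, i) ↦ ∫ f(y) α(h(y), T)ᵢ δ(t - arccos ⟨x, h(y)⟩) dy`. -/
def spatialRadon {d n k : ℕ} (h : USphere d → USphere n)
    (α : USphere n × SphericalTree n k → stdSimplex ℝ (Fin k)) (T : SphericalTree n k)
    (μ : Measure (USphere d)) : Measure (TreeSpace k) :=
  ∑ i : Fin k,
    (μ.withDensity fun y => ENNReal.ofReal ((α (h y, T) : Fin k → ℝ) i)).map (treeProj h T i)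

/-- The uniform probability distribution on the unit sphere of `ℝ^m`. -/
def uniformUnitSphere (m : ℕ) : Measure (Metric.sphere (0 : EuclideanSpace ℝ (Fin m)) 1) :=
  ((volume : Measure (EuclideanSpace ℝ (Fin m))).toSphere univ)⁻¹ •
    (volume : Measure (EuclideanSpace ℝ (Fin m))).toSphere

/-- The pole `e₀ = (1, 0, …, 0)` of `S^n`. -/
def pole (n : ℕ) : EuclideanSpace ℝ (Fin (n + 1)) := EuclideanSpace.single 0 1

/-- The embedding `z ↦ (0, z)` of `ℝ^n` as the hyperplane orthogonal to the pole of `S^n`. -/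
def equator {n : ℕ} (z : EuclideanSpace ℝ (Fin n)) : EuclideanSpace ℝ (Fin (n + 1)) :=
  WithLp.toLp 2 (Fin.cons 0 z.ofLp)

/-- The linear isometry of `ℝ^(n+1)` that exchanges the pole with `x ∈ S^n`; it is the reflection
in the hyperplane orthogonal to `e₀ - x`. It maps the hyperplane orthogonal to the pole onto the
hyperplane orthogonal to `x`. -/
def poleTo {n : ℕ} (x : USphere n) :
    EuclideanSpace ℝ (Fin (n + 1)) ≃ₗᵢ[ℝ] EuclideanSpace ℝ (Fin (n + 1)) :=
  (ℝ ∙ (pole n - (x : EuclideanSpace ℝ (Fin (n + 1)))))ᗮ.reflection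

theorem poleTo_pole {n : ℕ} (x : USphere n) : poleTo x (pole n) = x := by
  unfold poleTo
  apply Submodule.reflection_sub
  simp [pole]

theorem norm_equator {n : ℕ} (z : EuclideanSpace ℝ (Fin n)) : ‖equator z‖ = ‖z‖ := by
  simp [equator, EuclideanSpace.norm_eq, Fin.sum_univ_succ]

theorem inner_pole_equator {n : ℕ} (z : EuclideanSpace ℝ (Fin n)) :
    inner ℝ (pole n) (equator z) = 0 := by
  simp [pole, equator, PiLp.inner_apply]

/-- The spherical tree with root `x` whose edges have the directions that correspond to
`z₁, …, z_k ∈ S^(n-1)` under the isometry `poleTo x ∘ equator` of `ℝ^n` onto the hyperplane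
orthogonal to `x`. -/
def treeOf {n k : ℕ}
    (p : USphere n × (Fin k → Metric.sphere (0 : EuclideanSpace ℝ (Fin n)) 1)) :
    SphericalTree n k :=
  ⟨(p.1, fun i => ⟨poleTo p.1 (equator (p.2 i)), by
      rw [mem_sphere_zero_iff_norm, LinearIsometryEquiv.norm_map, norm_equator]
      exact norm_eq_of_mem_sphere (p.2 i)⟩), fun i => by
      have := (poleTo p.1).inner_map_map (pole n) (equator (p.2 i))
      rwa [poleTo_pole, inner_pole_equator] at this⟩

/-- The tree sampling distribution `σ` on the space of spherical trees with `k` edges in `S^n`: the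
root `x` is uniform on `S^n` and, given `x`, the directions of the edges are independent and uniform
on the unit sphere of the hyperplane orthogonal to `x`. -/
def treeSampling (n k : ℕ) : Measure (SphericalTree n k) :=
  ((uniformUnitSphere (n + 1)).prod (Measure.pi fun _ : Fin k => uniformUnitSphere n)).map treeOf

/-- The Spatial Spherical Tree-Sliced Wasserstein distance. -/
def spatialSTSW {d n k : ℕ} (h : USphere d → USphere n)
    (α : USphere n × SphericalTree n k → stdSimplex ℝ (Fin k))
    (μ ν : ProbabilityMeasure (USphere d)) : ℝ≥0∞ :=
  ∫⁻ T, wassersteinDist (spatialRadon h α T μ) (spatialRadon h α T ν) ∂(treeSampling n k)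

end

/-! Finiteness, symmetry and the triangle inequality pass from the Wasserstein distance on one tree
to its average over trees. Two points remain: measurability in the tree, and definiteness.

The integrand is even continuous. When `T` changes to `T'`, the mass at `y` can be moved so that as
much as possible stays on its edge: that part travels the difference of the two heights, the rest at
most `2 * π`. Dominated convergence makes this cost vanish as `T'` tends to `T`
(`tendsto_wassersteinDist_spatialRadon`), and the triangle inequality does the rest.

If the average is zero, both transforms agree for almost every tree. The distance to the root does
not see the edge and the weights sum to one, so `α` drops out and the law of `⟨x, h⟩` is the same
under `μ` and `ν` for almost every root `x` (`map_inner_eq_of_spatialRadon_eq`). By Cramér-Wold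
(`eq_of_ae_map_inner_eq`) the images under `h` coincide, and injectivity of `h` gives `μ = ν`. -/

/-! ### The Wasserstein distance on a metric space -/

section Wasserstein

variable {X : Type*} [MetricSpace X] [MeasurableSpace X]

theorem wassersteinDist_le {μ ν : Measure X} (γ : Measure (X × X)) (h₁ : γ.map Prod.fst = μ)
    (h₂ : γ.map Prod.snd = ν) : wassersteinDist μ ν ≤ ∫⁻ z, edist z.1 z.2 ∂γ :=
  iInf₂_le γ ⟨h₁, h₂⟩

theorem le_wassersteinDist {μ ν : Measure X} {C : ℝ≥0∞}
    (h : ∀ γ : Measure (X × X), γ.map Prod.fst = μ → γ.map Prod.snd = ν →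
      C ≤ ∫⁻ z, edist z.1 z.2 ∂γ) : C ≤ wassersteinDist μ ν :=
  le_iInf₂ fun γ hγ => h γ hγ.1 hγ.2

theorem wassersteinDist_le_of_edist_le {μ ν : Measure X} [IsProbabilityMeasure μ]
    [IsProbabilityMeasure ν] {C : ℝ≥0∞} (hC : ∀ x y : X, edist x y ≤ C) :
    wassersteinDist μ ν ≤ C := by
  refine (wassersteinDist_le (μ.prod ν) (by simp) (by simp)).trans ?_
  calc ∫⁻ z, edist z.1 z.2 ∂(μ.prod ν) ≤ ∫⁻ _, C ∂(μ.prod ν) :=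
        lintegral_mono fun z => hC z.1 z.2
    _ = C := by simp

variable [BorelSpace X] [SecondCountableTopology X]

theorem wassersteinDist_le_swap (μ ν : Measure X) :
    wassersteinDist μ ν ≤ wassersteinDist ν μ := by
  refine le_wassersteinDist fun γ h₁ h₂ => ?_
  refine (wassersteinDist_le (γ.map Prod.swap) ?_ ?_).trans ?_
  · rw [Measure.map_map measurable_fst measurable_swap]; exact h₂
  · rw [Measure.map_map measurable_snd measurable_swap]; exact h₁
  · rw [lintegral_map (by fun_prop) measurable_swap]
    simp [edist_comm]

theorem wassersteinDist_comm (μ ν : Measure X) : wassersteinDist μ ν = wassersteinDist ν μ :=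
  le_antisymm (wassersteinDist_le_swap μ ν) (wassersteinDist_le_swap ν μ)

theorem wassersteinDist_self (μ : Measure X) : wassersteinDist μ μ = 0 := by
  have hd : Measurable fun x : X => (x, x) := by fun_prop
  refine le_antisymm ((wassersteinDist_le (μ.map fun x => (x, x)) ?_ ?_).trans ?_) zero_le
  · rw [Measure.map_map measurable_fst hd]; exact Measure.map_id
  · rw [Measure.map_map measurable_snd hd]; exact Measure.map_id
  · rw [lintegral_map (by fun_prop) hd]; simp

/-- The gluing lemma: two couplings with a common marginal can be composed. -/
theorem wassersteinDist_triangle [StandardBorelSpace X] [Nonempty X] (μ ν ρ : Measure X)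
    [IsFiniteMeasure ν] :
    wassersteinDist μ ρ ≤ wassersteinDist μ ν + wassersteinDist ν ρ := by
  have key : ∀ γ₁ γ₂ : Measure (X × X), γ₁.map Prod.fst = μ → γ₁.map Prod.snd = ν →
      γ₂.map Prod.fst = ν → γ₂.map Prod.snd = ρ →
      wassersteinDist μ ρ ≤ ∫⁻ z, edist z.1 z.2 ∂γ₁ + ∫⁻ z, edist z.1 z.2 ∂γ₂ := by
    intro γ₁ γ₂ h₁ h₂ h₃ h₄
    have : IsFiniteMeasure γ₁ := ⟨by
      have := measure_lt_top ν univ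
      rwa [← h₂, Measure.map_apply measurable_snd .univ, preimage_univ] at this⟩
    have : IsFiniteMeasure γ₂ := ⟨by
      have := measure_lt_top ν univ
      rwa [← h₃, Measure.map_apply measurable_fst .univ, preimage_univ] at this⟩
    -- Given `(x, y)` distributed by `γ₁`, a third point is drawn from the conditional law of `γ₂`
    -- given that its first coordinate is `y`.
    set κ := γ₂.condKernel
    set η : ProbabilityTheory.Kernel (X × X) X := κ.comap Prod.snd measurable_snd
    set γ : Measure ((X × X) × X) := γ₁.compProd η
    have hγ₁ : γ.map Prod.fst = γ₁ := Measure.fst_compProd _ _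
    have hγ₂ : γ.map (fun z => (z.1.2, z.2)) = γ₂ := by
      rw [← γ₂.disintegrate κ]
      change _ = (γ₂.map Prod.fst).compProd κ
      rw [h₃, ← h₂]
      ext s hs
      have : SFinite (γ₁.map Prod.snd) := by rw [h₂]; infer_instance
      rw [Measure.map_apply (by fun_prop) hs, Measure.compProd_apply hs,
        Measure.compProd_apply (hs.preimage (by fun_prop)),
        lintegral_map (ProbabilityTheory.Kernel.measurable_kernel_prodMk_left hs) measurable_snd]
      rfl
    have hm : Measurable fun z : (X × X) × X => (z.1.1, z.2) := by fun_prop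
    refine (wassersteinDist_le (γ.map fun z => (z.1.1, z.2)) ?_ ?_).trans ?_
    · rw [Measure.map_map measurable_fst hm, ← h₁, ← hγ₁,
        Measure.map_map measurable_fst measurable_fst]
      rfl
    · rw [Measure.map_map measurable_snd hm, ← h₄, ← hγ₂,
        Measure.map_map measurable_snd (by fun_prop)]
      rfl
    · conv_rhs => rw [← hγ₁, ← hγ₂]
      rw [lintegral_map (by fun_prop) hm, lintegral_map (by fun_prop) measurable_fst,
        lintegral_map (by fun_prop) (by fun_prop), ← lintegral_add_left (by fun_prop)]
      exact lintegral_mono fun z => edist_triangle _ _ _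
  conv_rhs => rw [wassersteinDist, wassersteinDist]
  simp only [ENNReal.iInf_add, ENNReal.add_iInf]
  exact le_iInf₂ fun γ₂ h₂ => le_iInf₂ fun γ₁ h₁ => key γ₁ γ₂ h₁.1 h₁.2 h₂.1 h₂.2

/-- The easy half of Kantorovich-Rubinstein duality: integrate the Lipschitz bound against a
coupling. The bound `C` serves only integrability. -/
theorem enorm_integral_sub_div_le_wassersteinDist {μ ν : Measure X} [IsFiniteMeasure μ]
    {f : X → ℝ} {K : NNReal} (hK : LipschitzWith K f) {C : ℝ} (hC : ∀ x, ‖f x‖ ≤ C) :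
    ‖∫ x, f x ∂μ - ∫ x, f x ∂ν‖ₑ / K ≤ wassersteinDist μ ν := by
  refine le_wassersteinDist fun γ h₁ h₂ => ?_
  have hf := hK.continuous.measurable
  have : IsFiniteMeasure γ := ⟨by
    have := measure_lt_top μ univ
    rwa [← h₁, Measure.map_apply measurable_fst .univ, preimage_univ] at this⟩
  have hint : ∀ g : X × X → X, Measurable g → Integrable (fun z => f (g z)) γ := fun g hg =>
    Integrable.of_bound (hf.comp hg).aestronglyMeasurable C (.of_forall fun z => hC _)
  rw [← h₁, ← h₂, integral_map (by fun_prop) hf.aestronglyMeasurable,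
    integral_map (by fun_prop) hf.aestronglyMeasurable,
    ← integral_sub (hint _ measurable_fst) (hint _ measurable_snd)]
  refine ENNReal.div_le_of_le_mul' ?_
  rw [← lintegral_const_mul _ (by fun_prop)]
  refine (enorm_integral_le_lintegral_enorm _).trans (lintegral_mono fun z => ?_)
  rw [← edist_eq_enorm_sub]
  exact hK z.1 z.2

theorem eq_of_wassersteinDist_eq_zero {μ ν : Measure X} [IsProbabilityMeasure μ]
    [IsProbabilityMeasure ν] (h : wassersteinDist μ ν = 0) : μ = ν := by
  obtain ⟨x₀⟩ : Nonempty X := nonempty_of_isProbabilityMeasure μ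
  let μ' : ProbabilityMeasure X := ⟨μ, inferInstance⟩
  let ν' : ProbabilityMeasure X := ⟨ν, inferInstance⟩
  -- Bounded Lipschitz functions test weak convergence, so the constant sequence `μ` converges to
  -- `ν`, and weak limits are unique. No optimal coupling is needed.
  have hlim : Filter.Tendsto (fun _ : ℕ => μ') Filter.atTop (nhds ν') := by
    rw [tendsto_iff_forall_lipschitz_integral_tendsto]
    rintro f ⟨C, hC⟩ ⟨K, hK⟩
    have hbound : ∀ x, ‖f x‖ ≤ C + ‖f x₀‖ := fun x =>
      calc ‖f x‖ ≤ ‖f x - f x₀‖ + ‖f x₀‖ := norm_le_norm_sub_add _ _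
        _ ≤ C + ‖f x₀‖ := by rw [← dist_eq_norm]; gcongr; exact hC x x₀
    have hle := enorm_integral_sub_div_le_wassersteinDist (μ := μ) (ν := ν) hK hbound
    rw [h, nonpos_iff_eq_zero, ENNReal.div_eq_zero_iff] at hle
    have heq : ∫ x, f x ∂μ = ∫ x, f x ∂ν := by simpa [sub_eq_zero] using hle
    change Filter.Tendsto (fun _ => ∫ x, f x ∂μ) _ (nhds (∫ x, f x ∂ν))
    rw [heq]
    exact tendsto_const_nhds
  have heq : μ' = ν' := tendsto_nhds_unique tendsto_const_nhds hlim
  exact congrArg Subtype.val heq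

end Wasserstein

/-! ### Geometry of the tree -/

section TreeSpace

variable {k : ℕ}

theorem TreeSpace.exists_mk (p : TreeSpace k) : ∃ i t ht, p = TreeSpace.mk i t ht := by
  obtain ⟨⟨i, t, ht⟩, rfl⟩ := SeparationQuotient.surjective_mk p
  exact ⟨i, t, ht, rfl⟩

theorem TreeSpace.continuous_mk {Z : Type*} [TopologicalSpace Z] (i : Fin k) {f : Z → ℝ}
    (hf : Continuous f) (hmem : ∀ z, f z ∈ Icc 0 π) :
    Continuous fun z => TreeSpace.mk i (f z) (hmem z) := by
  have hiso : Isometry fun t : Icc 0 π => TreeSpace.mk i (t : ℝ) t.2 :=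
    Isometry.of_dist_eq fun s t => by
      rw [TreeSpace.dist_mk, if_pos rfl, Subtype.dist_eq, Real.dist_eq]
  exact hiso.continuous.comp (hf.subtype_mk hmem)

theorem TreeSpace.dist_mk_le (i j : Fin k) {s t : ℝ} (hs : s ∈ Icc 0 π) (ht : t ∈ Icc 0 π) :
    dist (TreeSpace.mk i s hs) (TreeSpace.mk j t ht) ≤ 2 * π := by
  rw [TreeSpace.dist_mk]
  have h₁ := hs.1; have h₂ := hs.2; have h₃ := ht.1; have h₄ := ht.2
  split_ifs
  · rw [abs_le]; constructor <;> linarith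
  · linarith

theorem TreeSpace.edist_le (p q : TreeSpace k) : edist p q ≤ ENNReal.ofReal (2 * π) := by
  obtain ⟨i, s, hs, rfl⟩ := p.exists_mk
  obtain ⟨j, t, ht, rfl⟩ := q.exists_mk
  rw [edist_dist]
  exact ENNReal.ofReal_le_ofReal (TreeSpace.dist_mk_le i j hs ht)

/-- Compactness makes the tree second countable and standard Borel, as the gluing lemma requires. -/
instance TreeSpace.instCompactSpace : CompactSpace (TreeSpace k) := by
  refine ⟨?_⟩
  have huniv : (univ : Set (TreeSpace k)) =
      ⋃ i : Fin k, range fun t : Icc 0 π => TreeSpace.mk i (t : ℝ) t.2 := by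
    refine (eq_univ_of_forall fun p => ?_).symm
    obtain ⟨i, t, ht, rfl⟩ := p.exists_mk
    exact mem_iUnion.2 ⟨i, ⟨t, ht⟩, rfl⟩
  rw [huniv]
  exact isCompact_iUnion fun i =>
    isCompact_range (TreeSpace.continuous_mk i continuous_subtype_val fun t => t.2)

theorem TreeSpace.dist_mk_zero (i j : Fin k) {t : ℝ} (ht : t ∈ Icc 0 π) :
    dist (TreeSpace.mk i t ht) (TreeSpace.mk j 0 (left_mem_Icc.2 Real.pi_pos.le)) = t := by
  rw [TreeSpace.dist_mk]
  split_ifs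
  · rw [sub_zero, abs_of_nonneg ht.1]
  · rw [add_zero]

end TreeSpace

/-! ### Couplings of two weight vectors -/

section SimplexCoupling

variable {ι : Type*} [Fintype ι] {a b : ι → ℝ}

theorem sum_max_sub_comm (h : ∑ i, a i = ∑ i, b i) :
    ∑ i, max (b i - a i) 0 = ∑ i, max (a i - b i) 0 := by
  rw [← sub_eq_zero, ← Finset.sum_sub_distrib]
  have : ∀ i, max (b i - a i) 0 - max (a i - b i) 0 = b i - a i := fun i => by grind
  simp [this, h]

variable [DecidableEq ι]

/-- A coupling of two points of the standard simplex that puts as much mass as possible on the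
diagonal. -/
noncomputable def simplexCoupling (a b : ι → ℝ) (i j : ι) : ℝ :=
  (if i = j then min (a i) (b i) else 0) +
    max (a i - b i) 0 * max (b j - a j) 0 / ∑ l, max (a l - b l) 0

theorem simplexCoupling_nonneg (ha : ∀ i, 0 ≤ a i) (hb : ∀ i, 0 ≤ b i) (i j : ι) :
    0 ≤ simplexCoupling a b i j := by
  refine add_nonneg ?_ (div_nonneg (by positivity) (Finset.sum_nonneg fun l _ => by positivity))
  split_ifs
  exacts [le_min (ha i) (hb i), le_rfl]

theorem simplexCoupling_swap (h : ∑ i, a i = ∑ i, b i) (i j : ι) :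
    simplexCoupling b a j i = simplexCoupling a b i j := by
  unfold simplexCoupling
  rw [sum_max_sub_comm h, mul_comm]
  by_cases hij : i = j
  · subst hij; simp [min_comm]
  · simp [hij, Ne.symm hij]

theorem sum_simplexCoupling_right (h : ∑ i, a i = ∑ i, b i) (i : ι) :
    ∑ j, simplexCoupling a b i j = a i := by
  simp only [simplexCoupling, Finset.sum_add_distrib, Finset.sum_ite_eq, Finset.mem_univ, if_true,
    ← Finset.sum_div, ← Finset.mul_sum, sum_max_sub_comm h]
  -- If there is no excess, then `a i ≤ b i`, the quotient is `0`, and the diagonal term alone is `a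
  -- i`.
  by_cases hS : ∑ l, max (a l - b l) 0 = 0
  · have := (Finset.sum_eq_zero_iff_of_nonneg fun l _ => le_max_right (a l - b l) 0).1 hS i
      (Finset.mem_univ i)
    rw [this]; grind
  · rw [mul_div_cancel_right₀ _ hS]; grind

theorem sum_simplexCoupling_left (h : ∑ i, a i = ∑ i, b i) (j : ι) :
    ∑ i, simplexCoupling a b i j = b j := by
  simp only [← simplexCoupling_swap h]
  exact sum_simplexCoupling_right h.symm j

/-- The diagonal part has mass at most `1` and costs at most `r` per unit; the remaining mass is the
total excess of `a` over `b` and costs at most `C` per unit. -/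
theorem sum_simplexCoupling_mul_le (ha : ∀ i, 0 ≤ a i) (hb : ∀ i, 0 ≤ b i) (ha₁ : ∑ i, a i = 1)
    (hb₁ : ∑ i, b i = 1) {D : ι → ι → ℝ} {r C : ℝ} (hr : 0 ≤ r)
    (hDr : ∀ i, D i i ≤ r) (hDC : ∀ i j, D i j ≤ C) :
    ∑ i, ∑ j, simplexCoupling a b i j * D i j ≤ r + C * ∑ i, max (a i - b i) 0 := by
  have hdiag : ∀ i, ∑ j, (if i = j then min (a i) (b i) else 0) * D i j ≤ a i * r := fun i => by
    simp only [ite_mul, zero_mul, Finset.sum_ite_eq, Finset.mem_univ, if_true]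
    calc min (a i) (b i) * D i i ≤ min (a i) (b i) * r := by
          gcongr
          exacts [le_min (ha i) (hb i), hDr i]
      _ ≤ a i * r := by gcongr; exact min_le_left _ _
  set S := ∑ l, max (a l - b l) 0
  have hS₀ : 0 ≤ S := Finset.sum_nonneg fun l _ => le_max_right _ _
  have hoff : ∀ i, ∑ j, max (a i - b i) 0 * max (b j - a j) 0 / S * D i j ≤
      C * max (a i - b i) 0 := fun i => by
    calc ∑ j, max (a i - b i) 0 * max (b j - a j) 0 / S * D i j
        ≤ ∑ j, max (a i - b i) 0 * max (b j - a j) 0 / S * C := by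
          gcongr with j; exact hDC i j
      _ = max (a i - b i) 0 * C * (S / S) := by
          rw [← Finset.sum_mul, ← Finset.sum_div, ← Finset.mul_sum,
            sum_max_sub_comm (ha₁.trans hb₁.symm)]
          ring
      _ = C * max (a i - b i) 0 := by
          by_cases hS : S = 0
          · have := (Finset.sum_eq_zero_iff_of_nonneg fun l _ => le_max_right (a l - b l) 0).1 hS i
              (Finset.mem_univ i)
            rw [this]; ring
          · rw [div_self hS]; ring
  calc ∑ i, ∑ j, simplexCoupling a b i j * D i j
      = ∑ i, (∑ j, (if i = j then min (a i) (b i) else 0) * D i j +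
          ∑ j, max (a i - b i) 0 * max (b j - a j) 0 / S * D i j) := by
        simp only [simplexCoupling, add_mul, Finset.sum_add_distrib, S]
    _ ≤ ∑ i, (a i * r + C * max (a i - b i) 0) := by
        gcongr with i; exacts [hdiag i, hoff i]
    _ = r + C * S := by
        rw [Finset.sum_add_distrib, ← Finset.sum_mul, ha₁, one_mul, ← Finset.mul_sum]

theorem measurable_simplexCoupling {Ω : Type*} [MeasurableSpace Ω] {f g : Ω → ι → ℝ}
    (hf : ∀ i, Measurable fun x => f x i) (hg : ∀ i, Measurable fun x => g x i) (i j : ι) :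
    Measurable fun x => simplexCoupling (f x) (g x) i j := by
  have hpos : ∀ l, Measurable fun x => max (f x l - g x l) 0 := fun l =>
    ((hf l).sub (hg l)).max measurable_const
  have hneg : ∀ l, Measurable fun x => max (g x l - f x l) 0 := fun l =>
    ((hg l).sub (hf l)).max measurable_const
  refine Measurable.add ?_ (((hpos i).mul (hneg j)).div
    (Finset.measurable_sum _ fun l _ => hpos l))
  split_ifs
  exacts [(hf i).min (hg i), measurable_const]

end SimplexCoupling

/-! ### The spatial Radon transform and its dependence on the tree -/

section Radon

variable {d n k : ℕ} {h : USphere d → USphere n}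
  {α : USphere n × SphericalTree n k → stdSimplex ℝ (Fin k)}

/-- The height `t` of the projection of `y` to any edge of the tree `T`. -/
noncomputable def treeHeight (h : USphere d → USphere n) (T : SphericalTree n k) (y : USphere d) :
    ℝ :=
  Real.arccos (inner ℝ (T.root : EuclideanSpace ℝ (Fin (n + 1))) (h y))

theorem continuous_treeHeight (h_cont : Continuous h) {Z : Type*} [TopologicalSpace Z]
    {T : Z → SphericalTree n k} {y : Z → USphere d} (hT : Continuous T) (hy : Continuous y) :
    Continuous fun z => treeHeight h (T z) (y z) := by
  have hroot : Continuous fun z => (T z).root :=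
    continuous_fst.comp (continuous_subtype_val.comp hT)
  unfold treeHeight
  fun_prop

theorem treeHeight_mem (T : SphericalTree n k) (y : USphere d) : treeHeight h T y ∈ Icc 0 π :=
  ⟨Real.arccos_nonneg _, Real.arccos_le_pi _⟩

theorem treeProj_eq (T : SphericalTree n k) (i : Fin k) (y : USphere d) :
    treeProj h T i y = TreeSpace.mk i (treeHeight h T y) (treeHeight_mem T y) :=
  rfl

theorem measurable_treeProj (h_cont : Continuous h) (T : SphericalTree n k) (i : Fin k) :
    Measurable (treeProj h T i) :=
  (TreeSpace.continuous_mk i (continuous_treeHeight h_cont continuous_const continuous_id)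
    (treeHeight_mem T)).measurable

theorem continuous_weight (h_cont : Continuous h) (α_cont : Continuous α) (i : Fin k) {Z : Type*}
    [TopologicalSpace Z] {T : Z → SphericalTree n k} {y : Z → USphere d} (hT : Continuous T)
    (hy : Continuous y) : Continuous fun z => (α (h (y z), T z) : Fin k → ℝ) i :=
  (continuous_apply i).comp (continuous_subtype_val.comp
    (α_cont.comp ((h_cont.comp hy).prodMk hT)))

theorem measurable_weight (h_cont : Continuous h) (α_cont : Continuous α)
    (T : SphericalTree n k) (i : Fin k) :
    Measurable fun y : USphere d => (α (h y, T) : Fin k → ℝ) i :=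
  (continuous_weight h_cont α_cont i continuous_const continuous_id).measurable

theorem withDensity_finsetSum {Ω ι : Type*} [MeasurableSpace Ω] (μ : Measure Ω) (s : Finset ι)
    {f : ι → Ω → ℝ≥0∞} (hf : ∀ i, Measurable (f i)) :
    μ.withDensity (fun x => ∑ i ∈ s, f i x) = ∑ i ∈ s, μ.withDensity (f i) := by
  classical
  induction s using Finset.induction_on with
  | empty => simp
  | insert i s hi ih =>
    simp only [Finset.sum_insert hi]
    rw [← ih]
    exact withDensity_add_left (hf i) _

theorem withDensity_ofReal_sum {Ω ι : Type*} [MeasurableSpace Ω] (μ : Measure Ω) (s : Finset ι)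
    {f : ι → Ω → ℝ} (hf : ∀ i, Measurable (f i)) (hf₀ : ∀ i x, 0 ≤ f i x) :
    μ.withDensity (fun x => ENNReal.ofReal (∑ i ∈ s, f i x)) =
      ∑ i ∈ s, μ.withDensity fun x => ENNReal.ofReal (f i x) := by
  simp only [ENNReal.ofReal_sum_of_nonneg fun i _ => hf₀ i _]
  exact withDensity_finsetSum μ s fun i => (hf i).ennreal_ofReal

/-- A function that does not distinguish the edges sees only the sum of the weights, which is one,
so the splitting map disappears. -/
theorem map_spatialRadon (h_cont : Continuous h) (α_cont : Continuous α) (T : SphericalTree n k)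
    (μ : Measure (USphere d)) {Z : Type*} [MeasurableSpace Z] {f : TreeSpace k → Z}
    (hf : Measurable f) {g : USphere d → Z} (hg : Measurable g)
    (hfg : ∀ i y, f (treeProj h T i y) = g y) :
    (spatialRadon h α T μ).map f = μ.map g := by
  rw [spatialRadon, Measure.map_finset_sum' hf.aemeasurable]
  have : ∀ i, ((μ.withDensity fun y => ENNReal.ofReal ((α (h y, T) : Fin k → ℝ) i)).map
      (treeProj h T i)).map f =
      (μ.withDensity fun y => ENNReal.ofReal ((α (h y, T) : Fin k → ℝ) i)).map g := fun i => by
    rw [Measure.map_map hf (measurable_treeProj h_cont T i)]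
    congr 1
    exact funext (hfg i)
  simp only [this]
  rw [← Measure.map_finset_sum' hg.aemeasurable, ← withDensity_ofReal_sum μ _
    (measurable_weight h_cont α_cont T)
    fun i y => (α (h y, T)).2.1 i]
  have hsum : ∀ y, ∑ i, (α (h y, T) : Fin k → ℝ) i = 1 := fun y => (α (h y, T)).2.2
  simp [hsum]

theorem isProbabilityMeasure_spatialRadon (h_cont : Continuous h) (α_cont : Continuous α)
    (T : SphericalTree n k) (μ : Measure (USphere d)) [IsProbabilityMeasure μ] :
    IsProbabilityMeasure (spatialRadon h α T μ) := by
  -- The map to a one-point space records exactly the total mass.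
  have hmap := map_spatialRadon h_cont α_cont T μ (measurable_const (a := ()))
    (measurable_const (a := ())) fun _ _ => rfl
  have := Measure.isProbabilityMeasure_map (μ := μ) (measurable_const (a := ())).aemeasurable
  rw [← hmap] at this
  exact Measure.isProbabilityMeasure_of_map fun _ => ()

/-- The spatial Radon transform determines the distribution of `⟨x, h⟩`, where `x` is the root. -/
theorem map_inner_eq_of_spatialRadon_eq (hk : 0 < k) (h_cont : Continuous h)
    (α_cont : Continuous α) (T : SphericalTree n k) {μ ν : Measure (USphere d)}
    (heq : spatialRadon h α T μ = spatialRadon h α T ν) :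
    μ.map (fun y => inner ℝ (T.root : EuclideanSpace ℝ (Fin (n + 1))) (h y)) =
      ν.map fun y => inner ℝ (T.root : EuclideanSpace ℝ (Fin (n + 1))) (h y) := by
  let o : TreeSpace k := TreeSpace.mk ⟨0, hk⟩ 0 (left_mem_Icc.2 Real.pi_pos.le)
  -- The distance to the root is the height on every edge; its cosine undoes the `arccos`.
  have hf : Measurable fun p : TreeSpace k => Real.cos (dist p o) := by fun_prop
  have hg : Measurable fun y => inner ℝ (T.root : EuclideanSpace ℝ (Fin (n + 1))) (h y) := by
    fun_prop
  have hfg : ∀ i y, Real.cos (dist (treeProj h T i y) o) =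
      inner ℝ (T.root : EuclideanSpace ℝ (Fin (n + 1))) (h y) := fun i y => by
    have hle := abs_le.1 (abs_real_inner_le_norm (T.root : EuclideanSpace ℝ (Fin (n + 1))) (h y))
    rw [norm_eq_of_mem_sphere, norm_eq_of_mem_sphere, one_mul] at hle
    rw [treeProj_eq, TreeSpace.dist_mk_zero, treeHeight, Real.cos_arccos hle.1 hle.2]
  rw [← map_spatialRadon h_cont α_cont T μ hf hg hfg, heq,
    map_spatialRadon h_cont α_cont T ν hf hg hfg]

/-- Over each `y`, the two weight vectors are coupled by `simplexCoupling`, which splits the mass at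
`y` among pairs of edges. -/
theorem wassersteinDist_spatialRadon_le (h_cont : Continuous h) (α_cont : Continuous α)
    (T T' : SphericalTree n k) (μ : Measure (USphere d)) :
    wassersteinDist (spatialRadon h α T μ) (spatialRadon h α T' μ) ≤
      ∫⁻ y, ENNReal.ofReal (|treeHeight h T y - treeHeight h T' y| +
        2 * π * ∑ i, max ((α (h y, T) : Fin k → ℝ) i - (α (h y, T') : Fin k → ℝ) i) 0) ∂μ := by
  let c : Fin k → Fin k → USphere d → ℝ := fun i j y =>
    simplexCoupling (α (h y, T) : Fin k → ℝ) (α (h y, T') : Fin k → ℝ) i j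
  have hα : ∀ T i, Measurable fun y => (α (h y, T) : Fin k → ℝ) i :=
    measurable_weight h_cont α_cont
  have hc₀ : ∀ i j y, 0 ≤ c i j y := fun i j y =>
    simplexCoupling_nonneg (α (h y, T)).2.1 (α (h y, T')).2.1 i j
  have hsum : ∀ y, ∑ i, (α (h y, T) : Fin k → ℝ) i = ∑ i, (α (h y, T') : Fin k → ℝ) i := fun y =>
    (α (h y, T)).2.2.trans (α (h y, T')).2.2.symm
  have hcm : ∀ i j, Measurable (c i j) := fun i j =>
    measurable_simplexCoupling (hα T) (hα T') i j
  have hp : ∀ (T : SphericalTree n k) i, Measurable (treeProj h T i) := measurable_treeProj h_cont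
  have hpp : ∀ i j, Measurable fun y => (treeProj h T i y, treeProj h T' j y) := fun i j =>
    (hp T i).prodMk (hp T' j)
  refine (wassersteinDist_le (∑ i, ∑ j, (μ.withDensity fun y => ENNReal.ofReal (c i j y)).map
    fun y => (treeProj h T i y, treeProj h T' j y)) ?_ ?_).trans ?_
  · simp only [Measure.map_finset_sum' measurable_fst.aemeasurable,
      Measure.map_map measurable_fst (hpp _ _)]
    refine Finset.sum_congr rfl fun i _ => ?_
    change ∑ j, Measure.map (treeProj h T i) _ = _
    rw [← Measure.map_finset_sum' (hp T i).aemeasurable,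
      ← withDensity_ofReal_sum μ _ (hcm i) (hc₀ i)]
    simp only [c, sum_simplexCoupling_right (hsum _)]
  · simp only [Measure.map_finset_sum' measurable_snd.aemeasurable,
      Measure.map_map measurable_snd (hpp _ _)]
    rw [Finset.sum_comm]
    refine Finset.sum_congr rfl fun j _ => ?_
    change ∑ i, Measure.map (treeProj h T' j) _ = _
    rw [← Measure.map_finset_sum' (hp T' j).aemeasurable,
      ← withDensity_ofReal_sum μ _ (fun i => hcm i j) (fun i => hc₀ i j)]
    simp only [c, sum_simplexCoupling_left (hsum _)]
  · have hterm : ∀ i j, ∫⁻ z, edist z.1 z.2 ∂((μ.withDensity fun y =>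
        ENNReal.ofReal (c i j y)).map fun y => (treeProj h T i y, treeProj h T' j y)) =
        ∫⁻ y, ENNReal.ofReal (c i j y * dist (treeProj h T i y) (treeProj h T' j y)) ∂μ := by
      intro i j
      have hd : Measurable fun y => edist (treeProj h T i y) (treeProj h T' j y) :=
        (hp T i).edist (hp T' j)
      rw [lintegral_map (by fun_prop) (hpp i j),
        lintegral_withDensity_eq_lintegral_mul _ (hcm i j).ennreal_ofReal hd]
      refine lintegral_congr fun y => ?_
      simp only [Pi.mul_apply]
      rw [ENNReal.ofReal_mul (hc₀ i j y), edist_dist]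
    have hm : ∀ i j, Measurable fun y =>
        ENNReal.ofReal (c i j y * dist (treeProj h T i y) (treeProj h T' j y)) := fun i j =>
      ((hcm i j).mul ((hp T i).dist (hp T' j))).ennreal_ofReal
    simp only [lintegral_finsetSum_measure, hterm]
    simp only [← lintegral_finsetSum _ fun j _ => hm _ j]
    rw [← lintegral_finsetSum _ fun i _ => Finset.measurable_sum _ fun j _ => hm i j]
    refine lintegral_mono fun y => ?_
    have hnn : ∀ i j, 0 ≤ c i j y * dist (treeProj h T i y) (treeProj h T' j y) := fun i j =>
      mul_nonneg (hc₀ i j y) dist_nonneg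
    simp only [← ENNReal.ofReal_sum_of_nonneg fun j _ => hnn _ j]
    rw [← ENNReal.ofReal_sum_of_nonneg fun i _ => Finset.sum_nonneg fun j _ => hnn i j]
    refine ENNReal.ofReal_le_ofReal (sum_simplexCoupling_mul_le (α (h y, T)).2.1 (α (h y, T')).2.1
      (α (h y, T)).2.2 (α (h y, T')).2.2 (abs_nonneg _) (fun i => ?_) fun i j => ?_)
    · rw [treeProj_eq, treeProj_eq, TreeSpace.dist_mk, if_pos rfl]
    · exact TreeSpace.dist_mk_le _ _ _ _

theorem tendsto_wassersteinDist_spatialRadon (h_cont : Continuous h) (α_cont : Continuous α)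
    (T : SphericalTree n k) (μ : Measure (USphere d)) [IsProbabilityMeasure μ] :
    Filter.Tendsto (fun T' => wassersteinDist (spatialRadon h α T μ) (spatialRadon h α T' μ))
      (nhds T) (nhds 0) := by
  refine tendsto_of_tendsto_of_tendsto_of_le_of_le tendsto_const_nhds ?_ (fun _ => zero_le)
    fun T' => wassersteinDist_spatialRadon_le h_cont α_cont T T' μ
  let F : SphericalTree n k → USphere d → ℝ := fun T' y =>
    |treeHeight h T y - treeHeight h T' y| +
      2 * π * ∑ i, max ((α (h y, T) : Fin k → ℝ) i - (α (h y, T') : Fin k → ℝ) i) 0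
  -- This form covers both measurability in `y` and convergence in `T'`.
  have hF : ∀ {Z : Type} [TopologicalSpace Z] {T' : Z → SphericalTree n k} {y : Z → USphere d},
      Continuous T' → Continuous y → Continuous fun z => F (T' z) (y z) := fun hT hy =>
    ((continuous_treeHeight h_cont continuous_const hy).sub
      (continuous_treeHeight h_cont hT hy)).abs.add
      (continuous_const.mul (continuous_finsetSum _ fun i _ =>
        ((continuous_weight h_cont α_cont i continuous_const hy).sub
          (continuous_weight h_cont α_cont i hT hy)).max continuous_const))
  have hbound : ∀ T' y, F T' y ≤ π + 2 * π := fun T' y => by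
    have h₁ := treeHeight_mem (h := h) T y
    have h₂ := treeHeight_mem (h := h) T' y
    have h₃ : |treeHeight h T y - treeHeight h T' y| ≤ π := by
      rw [abs_le]; constructor <;> linarith [h₁.1, h₁.2, h₂.1, h₂.2]
    have h₄ : ∑ i, max ((α (h y, T) : Fin k → ℝ) i - (α (h y, T') : Fin k → ℝ) i) 0 ≤ 1 := by
      rw [← (α (h y, T)).2.2]
      refine Finset.sum_le_sum fun i _ => max_le ?_ ((α (h y, T)).2.1 i)
      exact sub_le_self _ ((α (h y, T')).2.1 i)
    have := mul_le_mul_of_nonneg_left h₄ Real.two_pi_pos.le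
    simp only [F]
    linarith
  have hlim := tendsto_lintegral_filter_of_dominated_convergence (μ := μ) (l := nhds T)
    (F := fun T' y => ENNReal.ofReal (F T' y)) (f := fun y => ENNReal.ofReal (F T y))
    (fun _ => ENNReal.ofReal (π + 2 * π))
    (.of_forall fun T' => (hF continuous_const continuous_id).measurable.ennreal_ofReal)
    (.of_forall fun T' => .of_forall fun y => ENNReal.ofReal_le_ofReal (hbound T' y))
    (by simp) (.of_forall fun y => (ENNReal.continuous_ofReal.comp
      (hF continuous_id continuous_const)).tendsto T)
  have h0 : ∫⁻ y, ENNReal.ofReal (F T y) ∂μ = 0 := by simp [F]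
  rwa [h0] at hlim

/-- By the triangle inequality, the change in the distance is at most the sum of the displacements
of the two transforms. -/
theorem continuous_wassersteinDist_spatialRadon (hk : 0 < k) (h_cont : Continuous h)
    (α_cont : Continuous α) (μ ν : Measure (USphere d)) [IsProbabilityMeasure μ]
    [IsProbabilityMeasure ν] :
    Continuous fun T : SphericalTree n k =>
      wassersteinDist (spatialRadon h α T μ) (spatialRadon h α T ν) := by
  have : Nonempty (TreeSpace k) := ⟨TreeSpace.mk ⟨0, hk⟩ 0 (left_mem_Icc.2 Real.pi_pos.le)⟩
  have hprob : ∀ T (ρ : Measure (USphere d)) [IsProbabilityMeasure ρ],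
      IsProbabilityMeasure (spatialRadon h α T ρ) := fun T ρ _ =>
    isProbabilityMeasure_spatialRadon h_cont α_cont T ρ
  have hstep : ∀ T T', wassersteinDist (spatialRadon h α T μ) (spatialRadon h α T ν) ≤
      wassersteinDist (spatialRadon h α T' μ) (spatialRadon h α T' ν) +
      (wassersteinDist (spatialRadon h α T μ) (spatialRadon h α T' μ) +
        wassersteinDist (spatialRadon h α T ν) (spatialRadon h α T' ν)) := fun T T' => by
    have h₁ := wassersteinDist_triangle (spatialRadon h α T μ) (spatialRadon h α T' μ)
      (spatialRadon h α T ν)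
    have h₂ := wassersteinDist_triangle (spatialRadon h α T' μ) (spatialRadon h α T' ν)
      (spatialRadon h α T ν)
    rw [wassersteinDist_comm (spatialRadon h α T' ν)] at h₂
    calc _ ≤ _ := h₁
      _ ≤ _ := add_le_add_right h₂ _
      _ = _ := by ring
  refine continuous_iff_continuousAt.2 fun T => ?_
  have hfin : wassersteinDist (spatialRadon h α T μ) (spatialRadon h α T ν) ≠ ⊤ :=
    ((wassersteinDist_le_of_edist_le TreeSpace.edist_le).trans_lt ENNReal.ofReal_lt_top).ne
  have hlim := (tendsto_wassersteinDist_spatialRadon h_cont α_cont T μ).add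
    (tendsto_wassersteinDist_spatialRadon h_cont α_cont T ν)
  rw [add_zero] at hlim
  refine (ENNReal.tendsto_nhds hfin).2 fun ε hε => ?_
  filter_upwards [(hlim.eventually_le_const hε)] with T' hT'
  refine ⟨tsub_le_iff_right.2 ((hstep T T').trans (add_le_add_right hT' _)), ?_⟩
  refine (hstep T' T).trans (add_le_add_right ?_ _)
  rwa [wassersteinDist_comm, wassersteinDist_comm (spatialRadon h α T' ν)]

end Radon

/-! ### The sampling distribution of trees -/

section Sampling

instance uniformUnitSphere.instIsFiniteMeasure (m : ℕ) : IsFiniteMeasure (uniformUnitSphere m) :=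
  ⟨by
    rw [uniformUnitSphere, Measure.smul_apply, smul_eq_mul]
    exact (ENNReal.inv_mul_le_one _).trans_lt ENNReal.one_lt_top⟩

theorem toSphere_univ_ne_zero (m : ℕ) :
    (volume : Measure (EuclideanSpace ℝ (Fin (m + 1)))).toSphere univ ≠ 0 :=
  Measure.measure_univ_ne_zero.2 (Measure.toSphere_ne_zero _)

theorem isProbabilityMeasure_uniformUnitSphere {m : ℕ} (hm : 0 < m) :
    IsProbabilityMeasure (uniformUnitSphere m) := by
  obtain ⟨m, rfl⟩ := Nat.exists_eq_succ_of_ne_zero hm.ne'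
  refine ⟨?_⟩
  rw [uniformUnitSphere, Measure.smul_apply, smul_eq_mul]
  exact ENNReal.inv_mul_cancel (toSphere_univ_ne_zero m) (measure_ne_top _ _)

instance uniformUnitSphere.instIsOpenPosMeasure (m : ℕ) :
    (uniformUnitSphere m).IsOpenPosMeasure :=
  ⟨fun U hU hne => by
    rw [uniformUnitSphere, Measure.smul_apply, smul_eq_mul]
    exact mul_ne_zero (ENNReal.inv_ne_zero.2 (measure_ne_top _ _)) (hU.measure_ne_zero _ hne)⟩

variable {n k : ℕ}

/-- The explicit formula shows joint measurability in `x` and `v`. At `x = pole n` the subtracted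
vector is zero. -/
theorem poleTo_apply (x : USphere n) (v : EuclideanSpace ℝ (Fin (n + 1))) :
    poleTo x v = v - (2 * (inner ℝ (pole n - (x : EuclideanSpace ℝ (Fin (n + 1)))) v /
      ‖pole n - (x : EuclideanSpace ℝ (Fin (n + 1)))‖ ^ 2)) •
        (pole n - (x : EuclideanSpace ℝ (Fin (n + 1)))) := by
  rw [poleTo, Submodule.reflection_orthogonal_apply, Submodule.reflection_singleton_apply]
  simp [mul_smul, two_smul]

theorem measurable_treeOf : Measurable (treeOf (n := n) (k := k)) := by
  have heq : Continuous (equator (n := n)) := by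
    unfold equator
    refine (PiLp.continuous_toLp 2 _).comp (continuous_pi fun i => ?_)
    refine Fin.cases ?_ (fun j => ?_) i
    · simpa using continuous_const
    · simp only [Fin.cons_succ]; fun_prop
  have := heq.measurable
  refine Measurable.subtype_mk (measurable_fst.prodMk (measurable_pi_lambda _ fun i =>
    Measurable.subtype_mk ?_))
  simp only [poleTo_apply]
  fun_prop

/-- Fubini. The directions have a probability law because `0 < n`, so a suitable choice of them
exists for almost every root. -/
theorem ae_root_of_ae_treeSampling (hn : 0 < n) {p : USphere n → Prop}
    (hp : ∀ᵐ T ∂treeSampling n k, p T.root) : ∀ᵐ x ∂uniformUnitSphere (n + 1), p x := by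
  have := isProbabilityMeasure_uniformUnitSphere hn
  have h₁ := Measure.ae_ae_of_ae_prod (ae_of_ae_map measurable_treeOf.aemeasurable hp)
  filter_upwards [h₁] with x hx
  obtain ⟨z, hz⟩ := hx.exists
  exact hz

instance treeSampling.instIsFiniteMeasure : IsFiniteMeasure (treeSampling n k) := by
  unfold treeSampling
  infer_instance

end Sampling

/-! ### Cramér-Wold and the metric axioms -/

/-- A version of the Cramér-Wold theorem: a finite measure is determined by its projections to
almost all lines. -/
theorem eq_of_ae_map_inner_eq {m : ℕ} {μ ν : Measure (EuclideanSpace ℝ (Fin (m + 1)))}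
    [IsFiniteMeasure μ] [IsFiniteMeasure ν]
    (h : ∀ᵐ x : USphere m ∂uniformUnitSphere (m + 1),
      μ.map (fun y => inner ℝ (x : EuclideanSpace ℝ (Fin (m + 1))) y) =
        ν.map fun y => inner ℝ (x : EuclideanSpace ℝ (Fin (m + 1))) y) : μ = ν := by
  have hchar : ∀ (x : USphere m) (ρ : Measure (EuclideanSpace ℝ (Fin (m + 1)))) (t : ℝ),
      charFun ρ (t • (x : EuclideanSpace ℝ (Fin (m + 1)))) =
        charFun (ρ.map fun y => inner ℝ (x : EuclideanSpace ℝ (Fin (m + 1))) y) t := by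
    intro x ρ t
    rw [charFun_apply, charFun_apply_real, integral_map (by fun_prop) (by fun_prop)]
    simp [real_inner_smul_right, real_inner_comm]
  have hall : ∀ t : ℝ, (fun x : USphere m => charFun μ (t • (x : EuclideanSpace ℝ (Fin (m + 1))))) =
      fun x : USphere m => charFun ν (t • (x : EuclideanSpace ℝ (Fin (m + 1)))) := by
    intro t
    -- Continuous functions that agree almost everywhere agree everywhere, since the uniform measure
    -- charges every nonempty open set.
    refine Measure.eq_of_ae_eq (μ := uniformUnitSphere (m + 1)) ?_
      (continuous_charFun.comp (by fun_prop)) (continuous_charFun.comp (by fun_prop))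
    filter_upwards [h] with x hx
    rw [hchar, hchar, hx]
  refine Measure.ext_of_charFun (funext fun v => ?_)
  by_cases hv : v = 0
  · subst hv
    simpa using congrFun (hall 0) ⟨pole m, by simp [pole]⟩
  · have hv' : ‖v‖ ≠ 0 := norm_ne_zero_iff.2 hv
    have := congrFun (hall ‖v‖) ⟨‖v‖⁻¹ • v, by simp [norm_smul, hv']⟩
    simpa [smul_smul, hv'] using this

theorem mainTheorem5 (d n k : ℕ) (hd : 0 < d) (hn : 0 < n) (hk : 0 < k)
    (h : USphere d → USphere n) (h_cont : Continuous h) (h_inj : Function.Injective h)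
    (α : USphere n × SphericalTree n k → stdSimplex ℝ (Fin k)) (α_cont : Continuous α) :
    -- the integrand that defines the distance is measurable and finite
    (∀ μ ν : ProbabilityMeasure (USphere d),
      Measurable fun T : SphericalTree n k =>
        wassersteinDist (spatialRadon h α T μ) (spatialRadon h α T ν)) ∧
    (∀ (μ ν : ProbabilityMeasure (USphere d)) (T : SphericalTree n k),
      wassersteinDist (spatialRadon h α T μ) (spatialRadon h α T ν) < ∞) ∧
    -- the distance is a metric
    (∀ μ ν : ProbabilityMeasure (USphere d), spatialSTSW h α μ ν < ∞) ∧
    (∀ μ ν : ProbabilityMeasure (USphere d), spatialSTSW h α μ ν = 0 ↔ μ = ν) ∧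
    (∀ μ ν : ProbabilityMeasure (USphere d), spatialSTSW h α μ ν = spatialSTSW h α ν μ) ∧
    (∀ μ ν ρ : ProbabilityMeasure (USphere d),
      spatialSTSW h α μ ρ ≤ spatialSTSW h α μ ν + spatialSTSW h α ν ρ) := by
  have : Nonempty (TreeSpace k) := ⟨TreeSpace.mk ⟨0, hk⟩ 0 (left_mem_Icc.2 Real.pi_pos.le)⟩
  have hprob : ∀ T (μ : ProbabilityMeasure (USphere d)),
      IsProbabilityMeasure (spatialRadon h α T μ) := fun T μ =>
    isProbabilityMeasure_spatialRadon h_cont α_cont T μ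
  have hmeas : ∀ μ ν : ProbabilityMeasure (USphere d), Measurable fun T : SphericalTree n k =>
      wassersteinDist (spatialRadon h α T μ) (spatialRadon h α T ν) := fun μ ν =>
    (continuous_wassersteinDist_spatialRadon hk h_cont α_cont μ ν).measurable
  have hbound : ∀ (μ ν : ProbabilityMeasure (USphere d)) (T : SphericalTree n k),
      wassersteinDist (spatialRadon h α T μ) (spatialRadon h α T ν) ≤ ENNReal.ofReal (2 * π) :=
    fun μ ν T => wassersteinDist_le_of_edist_le TreeSpace.edist_le
  refine ⟨hmeas, fun μ ν T => (hbound μ ν T).trans_lt ENNReal.ofReal_lt_top, fun μ ν => ?_,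
    fun μ ν => ⟨fun h0 => ?_, ?_⟩, fun μ ν => ?_, fun μ ν ρ => ?_⟩
  · refine (lintegral_mono (hbound μ ν)).trans_lt ?_
    rw [lintegral_const]
    exact ENNReal.mul_lt_top ENNReal.ofReal_lt_top (measure_lt_top _ _)
  · have hae := (lintegral_eq_zero_iff (hmeas μ ν)).1 h0
    have hvm : Measurable fun y => (h y : EuclideanSpace ℝ (Fin (n + 1))) :=
      (continuous_subtype_val.comp h_cont).measurable
    have hx : ∀ᵐ x : USphere n ∂uniformUnitSphere (n + 1),
        ((μ : Measure (USphere d)).map fun y => (h y : EuclideanSpace ℝ (Fin (n + 1)))).map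
            (fun v => inner ℝ (x : EuclideanSpace ℝ (Fin (n + 1))) v) =
          ((ν : Measure (USphere d)).map fun y => (h y : EuclideanSpace ℝ (Fin (n + 1)))).map
            fun v => inner ℝ (x : EuclideanSpace ℝ (Fin (n + 1))) v := by
      refine ae_root_of_ae_treeSampling (k := k) hn ?_
      filter_upwards [hae] with T hT
      rw [Measure.map_map (by fun_prop) hvm, Measure.map_map (by fun_prop) hvm]
      exact map_inner_eq_of_spatialRadon_eq hk h_cont α_cont T (eq_of_wassersteinDist_eq_zero hT)
    -- A continuous injection of the sphere is a measurable embedding, so the pushforward can be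
    -- undone by `comap`.
    have hemb : MeasurableEmbedding fun y => (h y : EuclideanSpace ℝ (Fin (n + 1))) :=
      (continuous_subtype_val.comp h_cont).measurableEmbedding
        (Subtype.val_injective.comp h_inj)
    have heq := eq_of_ae_map_inner_eq hx
    refine Subtype.ext ?_
    have := congrArg (Measure.comap fun y => (h y : EuclideanSpace ℝ (Fin (n + 1)))) heq
    rwa [hemb.comap_map, hemb.comap_map] at this
  · rintro rfl
    simp [spatialSTSW, wassersteinDist_self]
  · simp only [spatialSTSW, wassersteinDist_comm (spatialRadon h α _ μ)]
  · rw [spatialSTSW, spatialSTSW, spatialSTSW, ← lintegral_add_left (hmeas μ ν)]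
    exact lintegral_mono fun T => wassersteinDist_triangle _ _ _
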